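/- Let $m\in\mathbb{N}$. A bounded matrix-valued Jacobi operator on $\ell^2(\mathbb{Z})^m$ is an operator $$(Hf)(k)=A(k)f(k+1)+A(k-1)f(k-1)+B(k)f(k),\qquad k\in\mathbb{Z},\ f\in\ell^2(\mathbb{Z})^m,$$ where $A(k),B(k)\in\mathbb{C}^{m\times m}$ satisfy $A(k)=A(k)^*>0$ (positive definite), $B(k)=B(k)^*$ for all $k\in\mathbb{Z}$, and $\sup_{k\in\mathbb{Z}}(\|A(k)\|+\|B(k)\|)<\infty$. Such an $H$ is bounded and self-adjoint; for $z\in\mathbb{C}\setminus\mathbb{R}$ and $k,\ell\in\mathbb{Z}$ let $G(z,k,\ell)=(H-z)^{-1}(k,\ell)\in\mathbb{C}^{m\times m}$ be its Green's matrix (the $(k,\ell)$ block of the resolvent), and let $g(z,k)=G(z,k,k)$. Fix $k_0\in\mathbb{Z}$. Then each of the following three sets of data uniquely determines $H$, and hence all coefficients $A(k)$, $B(k)$, $k\in\mathbb{Z}$, among bounded matrix-valued Jacobi operators on $\ell^2(\mathbb{Z})^m$: (i) $g(z,k_0)$ and $G(z,k_0,k_0+1)$ for all $z\in\mathbb{C}_+$;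 (ii) $g(z,k_0)$ and $G(z,k_0,k_0+1)+G(z,k_0+1,k_0)$ for all $z\in\mathbb{C}_+$; (iii) $g(z,k_0)$ and $g(z,k_0+1)$ for all $z\in\mathbb{C}_+$, together with $A(k_0)$. That is, if two such operators $H_1,H_2$ (with the same $m$) have the same data (i), or the same data (ii), or the same data (iii), then $H_1=H_2$, $A_1(k)=A_2(k)$ and $B_1(k)=B_2(k)$ for all $k\in\mathbb{Z}$. -/

import Mathlib

/-- The Hilbert space `ℓ²(ℤ)^m` of square-summable sequences `ℤ → ℂ^m`
(with the Euclidean norm on `ℂ^m`). -/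
abbrev JacobiSpace (m : ℕ) : Type :=
  lp (fun _ : ℤ => EuclideanSpace ℂ (Fin m)) 2

open scoped ComplexOrder in
/-- Coefficients of a bounded matrix-valued Jacobi operator: two-sided sequences of `m × m` matrices
with `A k` self-adjoint and positive definite, `B k` self-adjoint, and `‖A k‖ + ‖B k‖` bounded
uniformly in `k` (operator norm induced by the Euclidean norm on `ℂ^m`). -/
structure JacobiCoeff (m : ℕ) where
  A : ℤ → Matrix (Fin m) (Fin m) ℂ
  B : ℤ → Matrix (Fin m) (Fin m) ℂ
  A_posDef : ∀ k, (A k).PosDef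
  B_isHermitian : ∀ k, (B k).IsHermitian
  bounded : ∃ C : ℝ, 0 < C ∧ ∀ k,
    ‖Matrix.toEuclideanCLM (𝕜 := ℂ) (A k)‖ + ‖Matrix.toEuclideanCLM (𝕜 := ℂ) (B k)‖ ≤ C

theorem memlp_weightedShift {m : ℕ}
    (T : ℤ → (EuclideanSpace ℂ (Fin m) →L[ℂ] EuclideanSpace ℂ (Fin m)))
    (hT : ∃ C : ℝ, ∀ k, ‖T k‖ ≤ C) (s : ℤ) (f : JacobiSpace m) :
    Memℓp (fun k : ℤ => T k (f (k + s))) 2 := by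
  obtain ⟨C, hC⟩ := hT
  have hf : Summable fun k : ℤ => ‖f k‖ ^ (2 : ENNReal).toReal :=
    (lp.memℓp f).summable (by norm_num)
  have hs : Summable fun k : ℤ => ‖f (k + s)‖ ^ (2 : ENNReal).toReal :=
    hf.comp_injective (add_left_injective s)
  refine memℓp_gen (Summable.of_nonneg_of_le (fun k => by positivity) (fun k => ?_)
    (hs.mul_left (C ^ (2 : ENNReal).toReal)))
  rw [← Real.mul_rpow ((norm_nonneg _).trans (hC k)) (norm_nonneg _)]
  exact Real.rpow_le_rpow (norm_nonneg _)
    (((T k).le_opNorm _).trans (mul_le_mul_of_nonneg_right (hC k) (norm_nonneg _))) (by simp)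

theorem norm_weightedShift_le {m : ℕ}
    (T : ℤ → (EuclideanSpace ℂ (Fin m) →L[ℂ] EuclideanSpace ℂ (Fin m)))
    (hT : ∃ C : ℝ, ∀ k, ‖T k‖ ≤ C) (s : ℤ) :
    ∃ C : ℝ, ∀ f : JacobiSpace m,
      ‖(⟨fun k : ℤ => T k (f (k + s)), memlp_weightedShift T hT s f⟩ : JacobiSpace m)‖
        ≤ C * ‖f‖ := by
  have hT' := hT
  obtain ⟨C, hC⟩ := hT'
  have hC0 : 0 ≤ C := (norm_nonneg _).trans (hC 0)
  refine ⟨C, fun f => ?_⟩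
  have h2 : 0 < (2 : ENNReal).toReal := by norm_num
  have hf : Summable fun k : ℤ => ‖f k‖ ^ (2 : ENNReal).toReal := (lp.memℓp f).summable h2
  have hs : Summable fun k : ℤ => ‖f (k + s)‖ ^ (2 : ENNReal).toReal :=
    hf.comp_injective (add_left_injective s)
  refine lp.norm_le_of_tsum_le h2 (by positivity) ?_
  have hsum : ∑' k : ℤ, ‖f (k + s)‖ ^ (2 : ENNReal).toReal = ‖f‖ ^ (2 : ENNReal).toReal := by
    rw [lp.norm_rpow_eq_tsum h2 f]
    exact (Equiv.addRight s).tsum_eq (fun k : ℤ => ‖f k‖ ^ (2 : ENNReal).toReal)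
  rw [Real.mul_rpow hC0 (norm_nonneg _), ← hsum, ← tsum_mul_left]
  refine Summable.tsum_le_tsum (fun k => ?_) ((memlp_weightedShift T hT s f).summable h2)
    (hs.mul_left _)
  rw [← Real.mul_rpow hC0 (norm_nonneg _)]
  exact Real.rpow_le_rpow (norm_nonneg _)
    (((T k).le_opNorm _).trans (mul_le_mul_of_nonneg_right (hC k) (norm_nonneg _))) h2.le

/-- The bounded operator `f ↦ (k ↦ T k (f (k + s)))` on `ℓ²(ℤ)^m`, for bounded `T`. -/
noncomputable def weightedShift {m : ℕ}
    (T : ℤ → (EuclideanSpace ℂ (Fin m) →L[ℂ] EuclideanSpace ℂ (Fin m)))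
    (hT : ∃ C : ℝ, ∀ k, ‖T k‖ ≤ C) (s : ℤ) : JacobiSpace m →L[ℂ] JacobiSpace m :=
  LinearMap.mkContinuousOfExistsBound
    { toFun := fun f => ⟨fun k : ℤ => T k (f (k + s)), memlp_weightedShift T hT s f⟩
      map_add' := fun f g => by
        ext1; funext k; exact (T k).map_add (f (k + s)) (g (k + s))
      map_smul' := fun c f => by
        ext1; funext k; exact (T k).map_smul c (f (k + s)) }
    (norm_weightedShift_le T hT s)

theorem JacobiCoeff.bounded_A {m : ℕ} (J : JacobiCoeff m) :
    ∃ C : ℝ, ∀ k, ‖Matrix.toEuclideanCLM (𝕜 := ℂ) (J.A k)‖ ≤ C := by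
  obtain ⟨C, -, hC⟩ := J.bounded
  exact ⟨C, fun k => (le_add_of_nonneg_right (norm_nonneg _)).trans (hC k)⟩

theorem JacobiCoeff.bounded_A_pred {m : ℕ} (J : JacobiCoeff m) :
    ∃ C : ℝ, ∀ k : ℤ, ‖Matrix.toEuclideanCLM (𝕜 := ℂ) (J.A (k - 1))‖ ≤ C := by
  obtain ⟨C, hC⟩ := J.bounded_A
  exact ⟨C, fun k => hC (k - 1)⟩

theorem JacobiCoeff.bounded_B {m : ℕ} (J : JacobiCoeff m) :
    ∃ C : ℝ, ∀ k, ‖Matrix.toEuclideanCLM (𝕜 := ℂ) (J.B k)‖ ≤ C := by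
  obtain ⟨C, -, hC⟩ := J.bounded
  exact ⟨C, fun k => (le_add_of_nonneg_left (norm_nonneg _)).trans (hC k)⟩

/-- The Jacobi operator `H = A S⁺ + A⁻ S⁻ + B`, a bounded operator on all of `ℓ²(ℤ)^m`. -/
noncomputable def JacobiCoeff.op {m : ℕ} (J : JacobiCoeff m) :
    JacobiSpace m →L[ℂ] JacobiSpace m :=
  weightedShift (fun k => Matrix.toEuclideanCLM (𝕜 := ℂ) (J.A k)) J.bounded_A 1
    + weightedShift (fun k => Matrix.toEuclideanCLM (𝕜 := ℂ) (J.A (k - 1))) J.bounded_A_pred (-1)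
    + weightedShift (fun k => Matrix.toEuclideanCLM (𝕜 := ℂ) (J.B k)) J.bounded_B 0

/-- `(H f)(k) = A(k) f(k+1) + A(k-1) f(k-1) + B(k) f(k)`. -/
theorem JacobiCoeff.op_apply {m : ℕ} (J : JacobiCoeff m) (f : JacobiSpace m) (k : ℤ) :
    J.op f k = Matrix.toEuclideanCLM (𝕜 := ℂ) (J.A k) (f (k + 1))
      + Matrix.toEuclideanCLM (𝕜 := ℂ) (J.A (k - 1)) (f (k - 1))
      + Matrix.toEuclideanCLM (𝕜 := ℂ) (J.B k) (f k) := by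
  have h : J.op f k = Matrix.toEuclideanCLM (𝕜 := ℂ) (J.A k) (f (k + 1))
      + Matrix.toEuclideanCLM (𝕜 := ℂ) (J.A (k - 1)) (f (k + -1))
      + Matrix.toEuclideanCLM (𝕜 := ℂ) (J.B k) (f (k + 0)) := rfl
  rw [h, add_zero, ← sub_eq_add_neg]

/-- The Green's matrix `G(z,k,ℓ) = (H - z)⁻¹(k,ℓ)`: the `m × m` matrix whose `(i,j)` entry is the
`i`-th component at site `k` of `(H - z)⁻¹` applied to the sequence supported at site `ℓ` with value
the `j`-th standard basis vector. `Ring.inverse` is the inverse in the algebra of bounded operators;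
it is the genuine inverse for all non-real `z`, as `H` is self-adjoint. -/
noncomputable def JacobiCoeff.green {m : ℕ} (J : JacobiCoeff m) (z : ℂ) (k l : ℤ) :
    Matrix (Fin m) (Fin m) ℂ :=
  Matrix.of fun i j =>
    (Ring.inverse (J.op - z • (1 : JacobiSpace m →L[ℂ] JacobiSpace m))
      (lp.single 2 l (EuclideanSpace.single j (1 : ℂ)))) k i

/-- The diagonal Green's matrix `g(z,k) = G(z,k,k)`. -/
noncomputable def JacobiCoeff.diagGreen {m : ℕ} (J : JacobiCoeff m) (z : ℂ) (k : ℤ) :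
    Matrix (Fin m) (Fin m) ℂ :=
  J.green z k k

open Filter Topology Bornology

/-! Only the behaviour of the resolvent `R(z) = (z - H)⁻¹` at infinity is used. Its expansion there
turns equality of the blocks of `R` at `(k₀, k₀)` and `(k₀, k₀ + 1)` into equality of these blocks
for every power of `H` (`map_pow_eq_of_map_resolvent_eq`). Row `k₀` of the powers obeys a triangular
recurrence from which the coefficients are peeled off site by site in both directions; each step
yields the square of some `A(k)`, and positive definiteness recovers `A(k)` (`recurrence_unique`,
`eq_of_block_pow_eq`). This settles (i).

Cases (ii) and (iii) reduce to (i). If `P` projects onto the sites right of `k₀`, then `R[H, P]R =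
[R, P]`, and `[H, P]` involves only the bond from `k₀` to `k₀ + 1` (`block_resolvent_commutator`).
Write `A = A(k₀)`, `g`, `g₁` for the diagonal blocks of `R` at `k₀`, `k₀ + 1`, and `x`, `y` for its
blocks at `(k₀, k₀ + 1)`, `(k₀ + 1, k₀)`. The identity gives `gAy = xAg` and `xAx + x = gAg₁`. In
(ii) the difference of two candidates for `x` solves a homogeneous Sylvester equation, injective
near infinity since `A > 0` and `zg → 1`; in (iii) the quadratic equation has at most one small
solution, and `x → 0`. -/

/-! ### Algebra of the quadratic and Sylvester equations -/

theorem eq_of_mul_mul_add_eq {𝔸 : Type*} [NormedRing 𝔸] {a x y : 𝔸} (h : x * a * x + x = y * a * y + y)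
    (hx : ‖x * a‖ < 1 / 2) (hy : ‖a * y‖ < 1 / 2) : x = y := by
  -- This bounds `‖x - y‖` by `(‖xa‖ + ‖ay‖) ‖x - y‖`, with a factor below `1`.
  have key : x - y = -(x * a * (x - y) + (x - y) * (a * y)) := by
    have h' : x - y = y * a * y - x * a * x := by
      rw [sub_eq_sub_iff_add_eq_add, add_comm, h, add_comm]
    rw [h']
    have : x * a * (x - y) + (x - y) * (a * y) = x * a * x - y * a * y := by
      noncomm_ring
    rw [← h', this, neg_sub, h']
  by_contra hne
  have hpos : 0 < ‖x - y‖ := norm_pos_iff.mpr (sub_ne_zero.mpr hne)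
  have : ‖x - y‖ ≤ ‖x * a‖ * ‖x - y‖ + ‖x - y‖ * ‖a * y‖ := by
    conv_lhs => rw [key, norm_neg]
    exact (norm_add_le _ _).trans (add_le_add (norm_mul_le _ _) (norm_mul_le _ _))
  nlinarith

/-- Equal sums mean `y' - y = x - x'`, so subtracting the two relations leaves one unknown. The
result is homogeneous in `g`; the factor `z` makes the coefficient tend to `1`. -/
theorem sylvester_sub_eq_zero {𝔸 : Type*} [Ring 𝔸] [Algebra ℂ 𝔸] {a g x x' y y' : 𝔸}
    (h : g * a * y - x * a * g = 0) (h' : g * a * y' - x' * a * g = 0) (hs : x + y = x' + y')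
    (z : ℂ) : (x - x') * a * (z • g) + (z • g) * a * (x - x') = 0 := by
  have hy : y = x' + y' - x := by rw [← hs]; abel
  have : (x - x') * a * g + g * a * (x - x')
      = (g * a * y' - x' * a * g) - (g * a * y - x * a * g) := by
    rw [hy]; noncomm_ring
  rw [mul_smul_comm, smul_mul_assoc, smul_mul_assoc, ← smul_add, this, h, h', sub_zero, smul_zero]

/-! ### Resolvents at infinity and perturbed Sylvester operators -/

section BanachAlgebra

variable {𝔸 : Type*} [NormedRing 𝔸] [NormedAlgebra ℂ 𝔸]

theorem mul_resolvent {a : 𝔸} {z : ℂ} (hz : IsUnit (algebraMap ℂ 𝔸 z - a)) :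
    a * resolvent a z = z • resolvent a z - 1 := by
  have h := Ring.mul_inverse_cancel _ hz
  rw [sub_mul, ← Algebra.smul_def] at h
  rw [resolvent, ← h]
  abel

theorem pow_mul_resolvent {a : 𝔸} {z : ℂ} (hz : IsUnit (algebraMap ℂ 𝔸 z - a)) (n : ℕ) :
    a ^ n * resolvent a z
      = z ^ n • resolvent a z - ∑ i ∈ Finset.range n, z ^ (n - 1 - i) • a ^ i := by
  induction n with
  | zero => simp
  | succ n ih =>
    rw [pow_succ, mul_assoc, mul_resolvent hz, mul_sub, mul_smul_comm, ih, Finset.sum_range_succ,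
      smul_sub, smul_smul, ← pow_succ', Finset.smul_sum, mul_one, sub_sub]
    congr 2
    · refine Finset.sum_congr rfl fun i hi => ?_
      rw [smul_smul, ← pow_succ']
      congr 2
      have := Finset.mem_range.mp hi
      omega
    · simp

theorem resolvent_mul_commutator_mul_resolvent {a p : 𝔸} {z : ℂ}
    (hz : IsUnit (algebraMap ℂ 𝔸 z - a)) :
    resolvent a z * (a * p - p * a) * resolvent a z = resolvent a z * p - p * resolvent a z := by
  have h : a * p - p * a = p * (algebraMap ℂ 𝔸 z - a) - (algebraMap ℂ 𝔸 z - a) * p := by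
    rw [mul_sub, sub_mul, Algebra.commutes]; abel
  rw [h, resolvent, mul_sub, sub_mul, ← mul_assoc _ _ p, Ring.inverse_mul_cancel _ hz, one_mul,
    mul_assoc _ (p * _), mul_assoc p, Ring.mul_inverse_cancel _ hz, mul_one]

/-- An injective Sylvester operator `x ↦ x a + a x` stays injective under the perturbation
`x ↦ x a g + g a x` for `g` near `1`. -/
theorem exists_pos_forall_sylvester_eq_zero [FiniteDimensional ℂ 𝔸] {a : 𝔸}
    (ha : ∀ x : 𝔸, x * a + a * x = 0 → x = 0) :
    ∃ ε > 0, ∀ g x : 𝔸, ‖g - 1‖ < ε → x * a * g + g * a * x = 0 → x = 0 := by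
  obtain ⟨K, hK, hanti⟩ := LinearMap.exists_antilipschitzWith
    (LinearMap.mulRight ℂ a + LinearMap.mulLeft ℂ a) (LinearMap.ker_eq_bot'.mpr fun x hx => by
      exact ha x (by simpa using hx))
  -- `K` is the lower-bound constant of the unperturbed operator, and the perturbation costs at most
  -- `2‖a‖‖g - 1‖‖x‖`; the `+ 1` keeps the denominator positive when `a = 0`.
  refine ⟨1 / (2 * K * (‖a‖ + 1)), by positivity, fun g x hg h => ?_⟩
  by_contra hne
  have hpos : 0 < ‖x‖ := norm_pos_iff.mpr hne
  have h1 : ‖x‖ ≤ K * ‖x * a + a * x‖ := by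
    simpa using hanti.le_mul_dist x 0
  have h2 : x * a + a * x = -(x * a * (g - 1) + (g - 1) * a * x) := by
    have : x * a * (g - 1) + (g - 1) * a * x
      = (x * a * g + g * a * x) - (x * a + a * x) := by noncomm_ring
    rw [this, h]; abel
  have h3 : ‖x * a + a * x‖ ≤ ‖x‖ * ‖a‖ * ‖g - 1‖ + ‖g - 1‖ * ‖a‖ * ‖x‖ := by
    rw [h2, norm_neg]
    exact (norm_add_le _ _).trans (add_le_add
      (norm_mul_le_of_le (norm_mul_le _ _) le_rfl) (norm_mul_le_of_le (norm_mul_le _ _) le_rfl))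
  rw [lt_div_iff₀ (by positivity)] at hg
  have hK' : (0 : ℝ) < K := hK
  have h4 : ‖x‖ ≤ ‖x‖ * (‖g - 1‖ * (2 * K * ‖a‖)) :=
    (h1.trans (mul_le_mul_of_nonneg_left h3 hK'.le)).trans_eq (by ring)
  have h5 : ‖g - 1‖ * (2 * K * ‖a‖) ≤ ‖g - 1‖ * (2 * K * (‖a‖ + 1)) := by gcongr; linarith
  nlinarith

variable [CompleteSpace 𝔸]

theorem eventually_isUnit_algebraMap_sub (a : 𝔸) :
    ∀ᶠ z in cobounded ℂ, IsUnit (algebraMap ℂ 𝔸 z - a) := by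
  filter_upwards [spectrum.eventually_isUnit_resolvent (𝕜 := ℂ) a] with z hz
  exact spectrum.isUnit_resolvent.mpr hz

theorem tendsto_smul_resolvent (a : 𝔸) :
    Tendsto (fun z : ℂ => z • resolvent a z) (cobounded ℂ) (𝓝 1) := by
  have h : Tendsto (fun z : ℂ => a * resolvent a z + 1) (cobounded ℂ) (𝓝 1) := by
    simpa using ((spectrum.resolvent_tendsto_cobounded (𝕜 := ℂ) a).const_mul a).add_const 1
  refine h.congr' ?_
  filter_upwards [eventually_isUnit_algebraMap_sub a] with z hz
  rw [mul_resolvent hz, sub_add_cancel]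

/-- Functionals of the resolvents that agree near infinity agree on all powers. -/
theorem map_pow_eq_of_map_resolvent_eq {F : Type*} [NormedAddCommGroup F] [NormedSpace ℂ F]
    {l : Filter ℂ} [l.NeBot] (hl : l ≤ cobounded ℂ) (φ : 𝔸 →L[ℂ] F) {a b : 𝔸}
    (h : ∀ᶠ z in l, φ (resolvent a z) = φ (resolvent b z)) (n : ℕ) :
    φ (a ^ n) = φ (b ^ n) := by
  -- The polynomial in `pow_mul_resolvent` involves only powers below `n`, which agree by induction;
  -- the remaining term, times `z`, tends to the `n`-th power.
  induction n using Nat.strong_induction_on with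
  | _ n ih =>
    have lim (c : 𝔸) : Tendsto (fun z : ℂ => φ (z • (c ^ n * resolvent c z))) l
        (𝓝 (φ (c ^ n))) := by
      have := (φ.continuous.tendsto _).comp
        (((tendsto_smul_resolvent c).mono_left hl).const_mul (c ^ n))
      simpa [Function.comp_def] using this
    refine tendsto_nhds_unique (lim a) ((lim b).congr' ?_)
    filter_upwards [h, hl (eventually_isUnit_algebraMap_sub a),
      hl (eventually_isUnit_algebraMap_sub b)] with z hz ha hb
    rw [pow_mul_resolvent ha, pow_mul_resolvent hb]
    simp only [map_smul, map_sub, map_sum, hz]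
    congr 2
    exact Finset.sum_congr rfl fun i hi => by rw [ih i (Finset.mem_range.mp hi)]

end BanachAlgebra

/-! ### Inverse problem for a one-sided block recurrence -/

section Recurrence

variable {R : Type*} [Ring R]

/-- A one-sided block Jacobi recurrence `N (n+1) j = N n (j+1) a_j + N n (j-1) a_{j-1} + N n j b_j`
with triangular support is determined by its first two columns. -/
theorem recurrence_unique {N N' : ℕ → ℕ → R} {a a' b b' : ℕ → R}
    (hN : ∀ n j, N (n + 1) (j + 1) = N n (j + 2) * a (j + 1) + N n j * a j + N n (j + 1) * b (j + 1))
    (hN' : ∀ n j, N' (n + 1) (j + 1)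
      = N' n (j + 2) * a' (j + 1) + N' n j * a' j + N' n (j + 1) * b' (j + 1))
    (hsupp : ∀ n j, n < j → N n j = 0) (hsupp' : ∀ n j, n < j → N' n j = 0)
    (hone : N 0 0 = 1) (ha : ∀ j, IsUnit (a j))
    (hsq : ∀ j, a j * a j = a' j * a' j → a j = a' j)
    (h0 : ∀ n, N n 0 = N' n 0) (h1 : ∀ n, N n 1 = N' n 1) (ha0 : a 0 = a' 0) (j : ℕ) :
    a j = a' j ∧ b (j + 1) = b' (j + 1) := by
  have diag (j : ℕ) : N (j + 1) (j + 1) = N j j * a j := by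
    rw [hN, hsupp j (j + 2) (by omega), hsupp j (j + 1) (by omega)]; simp
  have diag' (j : ℕ) : N' (j + 1) (j + 1) = N' j j * a' j := by
    rw [hN', hsupp' j (j + 2) (by omega), hsupp' j (j + 1) (by omega)]; simp
  -- The diagonal entry `N j j` is the product `a 0 ⋯ a (j - 1)`.
  have unit (j : ℕ) : IsUnit (N j j) := by
    induction j with
    | zero => rw [hone]; exact isUnit_one
    | succ j ih => rw [diag]; exact ih.mul (ha j)
  have stepb (j : ℕ) (haj : a j = a' j) (hj : ∀ n, N n j = N' n j)
      (hj1 : ∀ n, N n (j + 1) = N' n (j + 1)) : b (j + 1) = b' (j + 1) := by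
    have e := hN (j + 1) j
    have e' := hN' (j + 1) j
    rw [hsupp (j + 1) (j + 2) (by omega), zero_mul, zero_add] at e
    rw [hsupp' (j + 1) (j + 2) (by omega), zero_mul, zero_add, ← hj1, ← hj, ← haj, ← hj1, e] at e'
    exact (unit (j + 1)).mul_left_cancel (add_left_cancel e')
  have main (j : ℕ) :
      a j = a' j ∧ (∀ n, N n j = N' n j) ∧ ∀ n, N n (j + 1) = N' n (j + 1) := by
    induction j with
    | zero => exact ⟨ha0, h0, h1⟩
    | succ j ih =>
      obtain ⟨haj, hj, hj1⟩ := ih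
      have hb := stepb j haj hj hj1
      -- Column `j + 2` is known only up to the right factor `a (j + 1)`; its diagonal entry then
      -- supplies `a (j + 1)` squared.
      have prod (n : ℕ) : N n (j + 2) * a (j + 1) = N' n (j + 2) * a' (j + 1) := by
        have e := hN n j
        rw [hj1, hN', ← hj, ← hj1, ← haj, ← hb] at e
        exact (add_right_cancel (add_right_cancel e)).symm
      have haj1 : a (j + 1) = a' (j + 1) := by
        refine hsq _ ((unit (j + 1)).mul_left_cancel ?_)
        have e := prod (j + 2)
        rw [diag, diag', ← hj1, mul_assoc, mul_assoc] at e
        exact e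
      refine ⟨haj1, hj1, fun n => (ha (j + 1)).mul_right_cancel ?_⟩
      rw [prod, haj1]
  exact ⟨(main j).1, stepb j (main j).1 (main j).2.1 (main j).2.2⟩

end Recurrence

/-! ### Positive definite Sylvester equation and square roots -/

section PosDef

open scoped ComplexOrder

variable {n : Type*} [Fintype n] [DecidableEq n]

/-- Multiplying by `X*` and taking traces gives `tr(X*AX) + tr(XCX*) = 0` with both terms
nonnegative, so `X*AX = 0`, and `A > 0` forces `X = 0`. -/
theorem Matrix.PosDef.eq_zero_of_mul_add_mul_eq_zero {A C : Matrix n n ℂ} (hA : A.PosDef)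
    (hC : C.PosDef) {X : Matrix n n ℂ} (h : X * C + A * X = 0) : X = 0 := by
  have h1 : (X.conjTranspose * A * X).PosSemidef := hA.posSemidef.conjTranspose_mul_mul_same X
  have h2 : (X * C * X.conjTranspose).PosSemidef := hC.posSemidef.mul_mul_conjTranspose_same X
  have hsum : (X.conjTranspose * A * X).trace + (X * C * X.conjTranspose).trace = 0 := by
    rw [Matrix.trace_mul_comm (X * C), ← Matrix.trace_add, mul_assoc, ← mul_add, add_comm, h,
      mul_zero, Matrix.trace_zero]
  have h0 : (X.conjTranspose * A * X).trace = 0 :=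
    ((add_eq_zero_iff_of_nonneg h1.trace_nonneg h2.trace_nonneg).mp hsum).1
  rw [h1.trace_eq_zero_iff] at h0
  by_contra hX
  obtain ⟨v, hv⟩ : ∃ v, X.mulVec v ≠ 0 := by
    by_contra! hall
    exact hX (Matrix.mulVec_injective (funext fun v => by simpa using hall v))
  have hpos := hA.re_dotProduct_pos hv
  have : star (X.mulVec v) ⬝ᵥ A.mulVec (X.mulVec v) = 0 := by
    rw [Matrix.star_mulVec, ← Matrix.dotProduct_mulVec, Matrix.mulVec_mulVec, Matrix.mulVec_mulVec,
      h0]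
    simp
  rw [this] at hpos
  simp at hpos

/-- Uniqueness of the positive square root: `(A - C)C + A(A - C) = A² - C²`. -/
theorem Matrix.PosDef.eq_of_mul_self_eq {A C : Matrix n n ℂ} (hA : A.PosDef) (hC : C.PosDef)
    (h : A * A = C * C) : A = C := by
  refine sub_eq_zero.mp (hA.eq_zero_of_mul_add_mul_eq_zero hC ?_)
  rw [sub_mul, mul_sub, h]
  abel

end PosDef

/-! ### Blocks of operators and the half-line projection -/

section Blocks

variable {m : ℕ}

/-- The embedding of `ℂ^m` into `ℓ²(ℤ)^m` as the sequences supported at site `l`. -/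
noncomputable abbrev siteEmbed (m : ℕ) (l : ℤ) : EuclideanSpace ℂ (Fin m) →L[ℂ] JacobiSpace m :=
  lp.singleContinuousLinearMap ℂ (fun _ : ℤ => EuclideanSpace ℂ (Fin m)) 2 l

/-- The value of a sequence at site `k`. -/
noncomputable abbrev siteEval (m : ℕ) (k : ℤ) : JacobiSpace m →L[ℂ] EuclideanSpace ℂ (Fin m) :=
  lp.evalCLM ℂ (fun _ : ℤ => EuclideanSpace ℂ (Fin m)) 2 k

/-- The `(k, l)` block of a bounded operator on `ℓ²(ℤ)^m`. -/
noncomputable def block (k l : ℤ) : (JacobiSpace m →L[ℂ] JacobiSpace m) →L[ℂ]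
    (EuclideanSpace ℂ (Fin m) →L[ℂ] EuclideanSpace ℂ (Fin m)) :=
  (ContinuousLinearMap.precomp _ (siteEmbed m l)).comp
    (ContinuousLinearMap.postcomp _ (siteEval m k))

theorem block_apply_apply (k l : ℤ) (T : JacobiSpace m →L[ℂ] JacobiSpace m)
    (v : EuclideanSpace ℂ (Fin m)) : block k l T v = T (lp.single 2 l v) k := rfl

theorem block_one (k l : ℤ) :
    block k l (1 : JacobiSpace m →L[ℂ] JacobiSpace m) = if k = l then 1 else 0 := by
  ext1 v
  rw [block_apply_apply]
  by_cases h : k = l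
  · subst h; simp
  · simp [h]

/-- The orthogonal projection of `ℓ²(ℤ)^m` onto the sequences supported to the right of `k₀`. -/
noncomputable def rightProj (m : ℕ) (k₀ : ℤ) : JacobiSpace m →L[ℂ] JacobiSpace m :=
  weightedShift (fun k => if k₀ < k then 1 else 0)
    ⟨max ‖(1 : EuclideanSpace ℂ (Fin m) →L[ℂ] EuclideanSpace ℂ (Fin m))‖ 0, fun k => by
      split_ifs <;> simp⟩ 0

theorem rightProj_apply (k₀ : ℤ) (f : JacobiSpace m) (k : ℤ) :
    rightProj m k₀ f k = if k₀ < k then f k else 0 := by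
  have h : rightProj m k₀ f k
    = (if k₀ < k then (1 : EuclideanSpace ℂ (Fin m) →L[ℂ] EuclideanSpace ℂ (Fin m)) else 0)
      (f (k + 0)) := rfl
  rw [h, add_zero]
  split_ifs <;> simp

theorem block_mul_rightProj (k₀ k l : ℤ) (T : JacobiSpace m →L[ℂ] JacobiSpace m) :
    block k l (T * rightProj m k₀) = if k₀ < l then block k l T else 0 := by
  ext1 v
  have h : rightProj m k₀ (lp.single 2 l v) = if k₀ < l then lp.single 2 l v else 0 := by
    ext1; funext j
    rw [rightProj_apply]
    rcases eq_or_ne j l with rfl | hj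
    · split_ifs <;> simp
    · split_ifs <;> simp [hj]
  rw [block_apply_apply, mul_apply_eq_comp, h]
  split_ifs
  · rfl
  · simp

theorem block_rightProj_mul (k₀ k l : ℤ) (T : JacobiSpace m →L[ℂ] JacobiSpace m) :
    block k l (rightProj m k₀ * T) = if k₀ < k then block k l T else 0 := by
  ext1 v
  rw [block_apply_apply, mul_apply_eq_comp, rightProj_apply]
  split_ifs <;> rfl

/-! ### Block identities and reconstruction from powers -/

namespace JacobiCoeff

variable (J : JacobiCoeff m)

/-- The off-diagonal coefficient `A k` as an operator on `ℂ^m`. -/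
noncomputable abbrev opA (k : ℤ) : EuclideanSpace ℂ (Fin m) →L[ℂ] EuclideanSpace ℂ (Fin m) :=
  Matrix.toEuclideanCLM (𝕜 := ℂ) (J.A k)

/-- The diagonal coefficient `B k` as an operator on `ℂ^m`. -/
noncomputable abbrev opB (k : ℤ) : EuclideanSpace ℂ (Fin m) →L[ℂ] EuclideanSpace ℂ (Fin m) :=
  Matrix.toEuclideanCLM (𝕜 := ℂ) (J.B k)

theorem isUnit_opA (k : ℤ) : IsUnit (J.opA k) :=
  open scoped ComplexOrder in (J.A_posDef k).isUnit.map (Matrix.toEuclideanCLM (𝕜 := ℂ))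

theorem op_single (l : ℤ) (v : EuclideanSpace ℂ (Fin m)) :
    J.op (lp.single 2 l v) = lp.single 2 (l + 1) (J.opA l v)
      + lp.single 2 (l - 1) (J.opA (l - 1) v) + lp.single 2 l (J.opB l v) := by
  ext1; funext k
  rw [op_apply]
  simp only [lp.coeFn_add, Pi.add_apply, lp.single_apply, Pi.single_apply]
  rcases lt_trichotomy k l with h | rfl | h
  · rcases eq_or_ne k (l - 1) with rfl | h'
    · simp [show l - 1 - 1 ≠ l by omega, show l - 1 ≠ l + 1 by omega]
    · simp [h.ne, h', show k + 1 ≠ l by omega, show k - 1 ≠ l by omega, show k ≠ l + 1 by omega]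
  · simp [show k ≠ k - 1 by omega]
  · rcases eq_or_ne k (l + 1) with rfl | h'
    · simp [show l + 1 + 1 ≠ l by omega, show l + 1 ≠ l - 1 by omega]
    · simp [h.ne', h', show k + 1 ≠ l by omega, show k - 1 ≠ l by omega, show k ≠ l - 1 by omega]

theorem block_mul_op (T : JacobiSpace m →L[ℂ] JacobiSpace m) (k l : ℤ) :
    block k l (T * J.op) = block k (l + 1) T * J.opA l + block k (l - 1) T * J.opA (l - 1)
      + block k l T * J.opB l := by
  ext1 v
  simp only [block_apply_apply, mul_apply_eq_comp, add_apply,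
    op_single, map_add, lp.coeFn_add, Pi.add_apply]

theorem op_commutator_rightProj (k₀ : ℤ) :
    J.op * rightProj m k₀ - rightProj m k₀ * J.op
      = (siteEmbed m k₀ ∘L J.opA k₀) ∘L siteEval m (k₀ + 1)
        - (siteEmbed m (k₀ + 1) ∘L J.opA k₀) ∘L siteEval m k₀ := by
  ext1 f
  ext1; funext k
  have h : (J.op * rightProj m k₀ - rightProj m k₀ * J.op) f k
      = J.op (rightProj m k₀ f) k - rightProj m k₀ (J.op f) k := rfl
  have h' : ((siteEmbed m k₀ ∘L J.opA k₀) ∘L siteEval m (k₀ + 1)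
        - (siteEmbed m (k₀ + 1) ∘L J.opA k₀) ∘L siteEval m k₀) f k
      = lp.single (E := fun _ : ℤ => EuclideanSpace ℂ (Fin m)) 2 k₀ (J.opA k₀ (f (k₀ + 1))) k
        - lp.single (E := fun _ : ℤ => EuclideanSpace ℂ (Fin m)) 2 (k₀ + 1) (J.opA k₀ (f k₀)) k :=
    rfl
  rw [h, h', rightProj_apply, op_apply, op_apply, rightProj_apply, rightProj_apply,
    rightProj_apply, lp.single_apply, lp.single_apply, Pi.single_apply, Pi.single_apply]
  rcases lt_trichotomy k k₀ with hk | rfl | hk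
  · simp [hk.ne, show ¬ k₀ < k by omega, show ¬ k₀ < k + 1 by omega, show ¬ k₀ < k - 1 by omega,
      show k ≠ k₀ + 1 by omega]
  · simp [show ¬ k < k - 1 by omega]
  · rcases eq_or_ne k (k₀ + 1) with rfl | h'
    · simp [show k₀ < k₀ + 1 + 1 by omega]
    · simp [hk, hk.ne', h', show k₀ < k + 1 by omega, show k₀ < k - 1 by omega]

theorem block_resolvent_commutator {z : ℂ} (hz : IsUnit (algebraMap ℂ _ z - J.op)) (k₀ k l : ℤ) :
    block k k₀ (resolvent J.op z) * J.opA k₀ * block (k₀ + 1) l (resolvent J.op z)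
      - block k (k₀ + 1) (resolvent J.op z) * J.opA k₀ * block k₀ l (resolvent J.op z)
      = (if k₀ < l then block k l (resolvent J.op z) else 0)
        - (if k₀ < k then block k l (resolvent J.op z) else 0) := by
  rw [← block_mul_rightProj, ← block_rightProj_mul, ← map_sub,
    ← resolvent_mul_commutator_mul_resolvent hz, op_commutator_rightProj, mul_sub, sub_mul, map_sub]
  rfl

/-- Finite propagation: each factor of `H` moves at most one site. -/
theorem block_pow_eq_zero (k : ℤ) (n : ℕ) :
    ∀ l : ℤ, (n : ℤ) < |l - k| → block k l (J.op ^ n) = 0 := by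
  induction n with
  | zero =>
    intro l hl
    rw [pow_zero, block_one, if_neg]
    rintro rfl
    simp at hl
  | succ n ih =>
    intro l hl
    push_cast at hl
    rw [pow_succ, block_mul_op, ih l (by grind), ih (l + 1) (by grind), ih (l - 1) (by grind)]
    simp

theorem block_op_succ (k : ℤ) : block k (k + 1) J.op = J.opA k := by
  have := J.block_mul_op 1 k (k + 1)
  rw [one_mul] at this
  rw [this]
  simp [block_one, show k ≠ k + 1 + 1 by omega]

theorem block_op_pred (k : ℤ) : block k (k - 1) J.op = J.opA (k - 1) := by
  have := J.block_mul_op 1 k (k - 1)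
  rw [one_mul] at this
  rw [this]
  simp [block_one, show k ≠ k - 1 - 1 by omega, show k ≠ k - 1 by omega]

theorem block_op_self (k : ℤ) : block k k J.op = J.opB k := by
  have := J.block_mul_op 1 k k
  rw [one_mul] at this
  rw [this]
  simp [block_one, show k ≠ k - 1 by omega]

theorem opA_eq_of_mul_self_eq {J J' : JacobiCoeff m} {k : ℤ}
    (h : J.opA k * J.opA k = J'.opA k * J'.opA k) : J.opA k = J'.opA k := by
  rw [opA, opA, ← map_mul, ← map_mul] at h
  rw [opA, opA, (J.A_posDef k).eq_of_mul_self_eq (J'.A_posDef k)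
    (Matrix.toEuclideanCLM (𝕜 := ℂ) |>.injective h)]

/-- The row blocks of all powers at `(k₀, k₀)` and `(k₀, k₀ + 1)` determine the coefficients. -/
theorem eq_of_block_pow_eq {J J' : JacobiCoeff m} {k₀ : ℤ}
    (h0 : ∀ n : ℕ, block k₀ k₀ (J.op ^ n) = block k₀ k₀ (J'.op ^ n))
    (h1 : ∀ n : ℕ, block k₀ (k₀ + 1) (J.op ^ n) = block k₀ (k₀ + 1) (J'.op ^ n)) :
    J = J' := by
  have hA0 : J.opA k₀ = J'.opA k₀ := by simpa [block_op_succ] using h1 1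
  have hB0 : J.opB k₀ = J'.opB k₀ := by simpa [block_op_self] using h0 1
  have right (j : ℕ) : J.opA (k₀ + j) = J'.opA (k₀ + j) ∧
      J.opB (k₀ + (j + 1 : ℕ)) = J'.opB (k₀ + (j + 1 : ℕ)) := by
    have rec' (K : JacobiCoeff m) (n j : ℕ) : block k₀ (k₀ + (j + 1 : ℕ)) (K.op ^ (n + 1))
        = block k₀ (k₀ + (j + 2 : ℕ)) (K.op ^ n) * K.opA (k₀ + (j + 1 : ℕ))
          + block k₀ (k₀ + j) (K.op ^ n) * K.opA (k₀ + j)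
          + block k₀ (k₀ + (j + 1 : ℕ)) (K.op ^ n) * K.opB (k₀ + (j + 1 : ℕ)) := by
      rw [pow_succ, block_mul_op]
      rw [show k₀ + ((j + 1 : ℕ) : ℤ) + 1 = k₀ + (j + 2 : ℕ) by push_cast; ring,
        show k₀ + ((j + 1 : ℕ) : ℤ) - 1 = k₀ + j by push_cast; ring]
    have supp (K : JacobiCoeff m) (n j : ℕ) (h : n < j) :
        block k₀ (k₀ + j) (K.op ^ n) = 0 := K.block_pow_eq_zero _ _ _ (by simp [h])
    exact recurrence_unique (N := fun n j => block k₀ (k₀ + j) (J.op ^ n))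
      (N' := fun n j => block k₀ (k₀ + j) (J'.op ^ n)) (a := fun j => J.opA (k₀ + j))
      (a' := fun j => J'.opA (k₀ + j)) (b := fun j => J.opB (k₀ + j))
      (b' := fun j => J'.opB (k₀ + j)) (rec' J) (rec' J') (supp J) (supp J')
      (by simp [block_one]) (fun j => J.isUnit_opA _) (fun j => opA_eq_of_mul_self_eq)
      (fun n => by simpa using h0 n) (fun n => by simpa using h1 n) (by simpa using hA0) j
  -- Column `k₀` of the next power couples columns `k₀ ± 1`; the right one is known, which frees the
  -- left one up to `A (k₀ - 1)`.
  have prod (n : ℕ) : block k₀ (k₀ - 1) (J.op ^ n) * J.opA (k₀ - 1)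
      = block k₀ (k₀ - 1) (J'.op ^ n) * J'.opA (k₀ - 1) := by
    have h := h0 (n + 1)
    rw [pow_succ, pow_succ, block_mul_op, block_mul_op, h0 n, h1 n, hA0, hB0] at h
    exact add_left_cancel (add_right_cancel h)
  have hA1 : J.opA (k₀ - 1) = J'.opA (k₀ - 1) :=
    opA_eq_of_mul_self_eq (by simpa [block_op_pred] using prod 1)
  have h1' (n : ℕ) : block k₀ (k₀ - 1) (J.op ^ n) = block k₀ (k₀ - 1) (J'.op ^ n) :=
    (J.isUnit_opA (k₀ - 1)).mul_right_cancel (by rw [prod, hA1])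
  -- `A k` sits on the bond from `k` to `k + 1`, so the leftward walk meets `A (k₀ - 1 - j)` between
  -- sites `k₀ - j` and `k₀ - j - 1`.
  have left (j : ℕ) : J.opA (k₀ - 1 - j) = J'.opA (k₀ - 1 - j) ∧
      J.opB (k₀ - (j + 1 : ℕ)) = J'.opB (k₀ - (j + 1 : ℕ)) := by
    have rec' (K : JacobiCoeff m) (n j : ℕ) : block k₀ (k₀ - (j + 1 : ℕ)) (K.op ^ (n + 1))
        = block k₀ (k₀ - (j + 2 : ℕ)) (K.op ^ n) * K.opA (k₀ - 1 - (j + 1 : ℕ))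
          + block k₀ (k₀ - j) (K.op ^ n) * K.opA (k₀ - 1 - j)
          + block k₀ (k₀ - (j + 1 : ℕ)) (K.op ^ n) * K.opB (k₀ - (j + 1 : ℕ)) := by
      rw [pow_succ, block_mul_op,
        show k₀ - ((j + 1 : ℕ) : ℤ) + 1 = k₀ - j by push_cast; ring,
        show k₀ - ((j + 1 : ℕ) : ℤ) - 1 = k₀ - (j + 2 : ℕ) by push_cast; ring,
        show k₀ - 1 - (j : ℤ) = k₀ - (j + 1 : ℕ) by push_cast; ring,
        show k₀ - 1 - ((j + 1 : ℕ) : ℤ) = k₀ - (j + 2 : ℕ) by push_cast; ring]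
      abel
    have supp (K : JacobiCoeff m) (n j : ℕ) (h : n < j) :
        block k₀ (k₀ - j) (K.op ^ n) = 0 := K.block_pow_eq_zero _ _ _ (by simp [h])
    exact recurrence_unique (N := fun n j => block k₀ (k₀ - j) (J.op ^ n))
      (N' := fun n j => block k₀ (k₀ - j) (J'.op ^ n)) (a := fun j => J.opA (k₀ - 1 - j))
      (a' := fun j => J'.opA (k₀ - 1 - j)) (b := fun j => J.opB (k₀ - j))
      (b' := fun j => J'.opB (k₀ - j)) (rec' J) (rec' J') (supp J) (supp J')
      (by simp [block_one]) (fun j => J.isUnit_opA _) (fun j => opA_eq_of_mul_self_eq)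
      (fun n => by simpa using h0 n) (fun n => by simpa using h1' n) (by simpa using hA1) j
  have hA (k : ℤ) : J.opA k = J'.opA k := by
    rcases le_or_gt k₀ k with hk | hk
    · obtain ⟨j, rfl⟩ := Int.le.dest hk
      exact (right j).1
    · obtain ⟨j, hj⟩ := Int.le.dest (show k ≤ k₀ - 1 by omega)
      rw [show k = k₀ - 1 - j by omega]
      exact (left j).1
  have hB (k : ℤ) : J.opB k = J'.opB k := by
    rcases lt_trichotomy k₀ k with hk | rfl | hk
    · obtain ⟨j, hj⟩ := Int.le.dest (show k₀ + 1 ≤ k by omega)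
      rw [show k = k₀ + (j + 1 : ℕ) by omega]
      exact (right j).2
    · exact hB0
    · obtain ⟨j, hj⟩ := Int.le.dest (show k ≤ k₀ - 1 by omega)
      rw [show k = k₀ - (j + 1 : ℕ) by omega]
      exact (left j).2
  have hA' : J.A = J'.A := funext fun k => Matrix.toEuclideanCLM (𝕜 := ℂ) |>.injective (hA k)
  have hB' : J.B = J'.B := funext fun k => Matrix.toEuclideanCLM (𝕜 := ℂ) |>.injective (hB k)
  cases J; cases J'
  simp_all

theorem toEuclideanCLM_green (z : ℂ) (k l : ℤ) :
    Matrix.toEuclideanCLM (𝕜 := ℂ) (J.green z k l) = -block k l (resolvent J.op z) := by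
  have hinv : Ring.inverse (J.op - z • (1 : JacobiSpace m →L[ℂ] JacobiSpace m))
      = -resolvent J.op z := by
    rw [resolvent, Algebra.algebraMap_eq_smul_one, ← neg_sub]
    generalize z • (1 : JacobiSpace m →L[ℂ] JacobiSpace m) - J.op = T
    by_cases hT : IsUnit T
    · obtain ⟨u, rfl⟩ := hT
      rw [← Units.val_neg, Ring.inverse_unit, Ring.inverse_unit, inv_neg, Units.val_neg]
    -- For `z` in the spectrum both inverses take the default value `0`.
    · rw [Ring.inverse_non_unit _ hT, Ring.inverse_non_unit _ (by simpa using hT), neg_zero]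
  refine ContinuousLinearMap.coe_injective
    ((EuclideanSpace.basisFun (Fin m) ℂ).toBasis.ext fun j => ?_)
  ext i
  rw [OrthonormalBasis.coe_toBasis, EuclideanSpace.basisFun_apply]
  change Matrix.toEuclideanCLM (𝕜 := ℂ) (J.green z k l) (EuclideanSpace.single j 1) i
    = (-block k l (resolvent J.op z)) (EuclideanSpace.single j 1) i
  rw [neg_apply, block_apply_apply, Matrix.ofLp_toEuclideanCLM]
  simp [green, hinv, Matrix.mulVec_single]

theorem green_eq_iff {J J' : JacobiCoeff m} {z : ℂ} {k l : ℤ} : J.green z k l = J'.green z k l ↔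
    block k l (resolvent J.op z) = block k l (resolvent J'.op z) := by
  rw [← (EquivLike.injective (Matrix.toEuclideanCLM (𝕜 := ℂ) (n := Fin m))).eq_iff, toEuclideanCLM_green,
    toEuclideanCLM_green, neg_inj]

theorem tendsto_block_resolvent (k l : ℤ) :
    Tendsto (fun z => block k l (resolvent J.op z)) (cobounded ℂ) (𝓝 0) := by
  simpa [Function.comp_def] using ((block k l).continuous.tendsto _).comp
    (spectrum.resolvent_tendsto_cobounded (𝕜 := ℂ) J.op)

theorem tendsto_smul_block_resolvent (k : ℤ) :
    Tendsto (fun z => z • block k k (resolvent J.op z)) (cobounded ℂ) (𝓝 1) := by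
  simpa [Function.comp_def, block_one] using ((block k k).continuous.tendsto _).comp
    (tendsto_smul_resolvent J.op)

/-! ### The three data sets -/

section Uniqueness

variable {J J' : JacobiCoeff m} {k₀ : ℤ} {l : Filter ℂ} [l.NeBot]

theorem eq_of_eventually_block_resolvent_eq (hl : l ≤ cobounded ℂ)
    (h0 : ∀ᶠ z in l, block k₀ k₀ (resolvent J.op z) = block k₀ k₀ (resolvent J'.op z))
    (h1 : ∀ᶠ z in l, block k₀ (k₀ + 1) (resolvent J.op z) = block k₀ (k₀ + 1) (resolvent J'.op z)) :
    J = J' :=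
  eq_of_block_pow_eq (map_pow_eq_of_map_resolvent_eq hl (block k₀ k₀) h0)
    (map_pow_eq_of_map_resolvent_eq hl (block k₀ (k₀ + 1)) h1)

theorem eq_of_eventually_block_resolvent_add_eq (hl : l ≤ cobounded ℂ)
    (h0 : ∀ᶠ z in l, block k₀ k₀ (resolvent J.op z) = block k₀ k₀ (resolvent J'.op z))
    (h1 : ∀ᶠ z in l, block k₀ (k₀ + 1) (resolvent J.op z) + block (k₀ + 1) k₀ (resolvent J.op z)
      = block k₀ (k₀ + 1) (resolvent J'.op z) + block (k₀ + 1) k₀ (resolvent J'.op z)) :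
    J = J' := by
  have hA : J.opA k₀ = J'.opA k₀ := by
    -- The first power has symmetrized block `2 A(k₀)`.
    have h := map_pow_eq_of_map_resolvent_eq hl (block k₀ (k₀ + 1) + block (k₀ + 1) k₀) h1 1
    have hpred (K : JacobiCoeff m) : block (k₀ + 1) k₀ K.op = K.opA k₀ := by
      simpa using K.block_op_pred (k₀ + 1)
    simp only [pow_one, add_apply, block_op_succ, hpred] at h
    rw [← two_smul ℂ, ← two_smul ℂ] at h
    exact smul_right_injective _ (two_ne_zero (α := ℂ)) h
  refine eq_of_eventually_block_resolvent_eq hl h0 ?_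
  obtain ⟨ε, hε, hsyl⟩ := exists_pos_forall_sylvester_eq_zero (a := J.opA k₀) fun x hx => by
    obtain ⟨X, rfl⟩ := EquivLike.surjective (Matrix.toEuclideanCLM (𝕜 := ℂ) (n := Fin m)) x
    rw [opA, ← map_mul, ← map_mul, ← map_add, map_eq_zero_iff _ (EquivLike.injective _)] at hx
    rw [(J.A_posDef k₀).eq_zero_of_mul_add_mul_eq_zero (J.A_posDef k₀) hx, map_zero]
  have hnear := (tendsto_iff_norm_sub_tendsto_zero.mp
    (J.tendsto_smul_block_resolvent k₀)).eventually_lt_const hε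
  filter_upwards [h0, h1, hl (eventually_isUnit_algebraMap_sub J.op),
    hl (eventually_isUnit_algebraMap_sub J'.op), hl hnear] with z hg hs hu hu' hz
  have c := J.block_resolvent_commutator hu k₀ k₀ k₀
  have c' := J'.block_resolvent_commutator hu' k₀ k₀ k₀
  rw [← hA, ← hg] at c'
  simp only [lt_irrefl, if_false, sub_zero] at c c'
  exact sub_eq_zero.mp (hsyl _ _ hz (sylvester_sub_eq_zero c c' hs z))

theorem eq_of_eventually_block_resolvent_diag_eq (hl : l ≤ cobounded ℂ)
    (h0 : ∀ᶠ z in l, block k₀ k₀ (resolvent J.op z) = block k₀ k₀ (resolvent J'.op z))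
    (h1 : ∀ᶠ z in l, block (k₀ + 1) (k₀ + 1) (resolvent J.op z)
      = block (k₀ + 1) (k₀ + 1) (resolvent J'.op z)) (hA : J.opA k₀ = J'.opA k₀) :
    J = J' := by
  refine eq_of_eventually_block_resolvent_eq hl h0 ?_
  have hx : ∀ᶠ z in cobounded ℂ, ‖block k₀ (k₀ + 1) (resolvent J.op z) * J.opA k₀‖ < 1 / 2 := by
    have := ((J.tendsto_block_resolvent k₀ (k₀ + 1)).mul_const (J.opA k₀)).norm
    rw [zero_mul, norm_zero] at this
    exact this.eventually_lt_const (by norm_num)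
  have hx' : ∀ᶠ z in cobounded ℂ, ‖J.opA k₀ * block k₀ (k₀ + 1) (resolvent J'.op z)‖ < 1 / 2 := by
    have := ((J'.tendsto_block_resolvent k₀ (k₀ + 1)).const_mul (J.opA k₀)).norm
    rw [mul_zero, norm_zero] at this
    exact this.eventually_lt_const (by norm_num)
  filter_upwards [h0, h1, hl (eventually_isUnit_algebraMap_sub J.op),
    hl (eventually_isUnit_algebraMap_sub J'.op), hl hx, hl hx'] with z hg hg1 hu hu' hz hz'
  have c := J.block_resolvent_commutator hu k₀ k₀ (k₀ + 1)
  have c' := J'.block_resolvent_commutator hu' k₀ k₀ (k₀ + 1)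
  rw [← hA, ← hg, ← hg1] at c'
  simp only [lt_irrefl, lt_add_one, if_true, if_false, sub_zero] at c c'
  refine eq_of_mul_mul_add_eq ?_ hz hz'
  rw [← sub_eq_iff_eq_add'.mp c, ← sub_eq_iff_eq_add'.mp c']

end Uniqueness

end JacobiCoeff

end Blocks

theorem theorem4p4 (m : ℕ) (k₀ : ℤ) (J₁ J₂ : JacobiCoeff m) :
    ((∀ z : ℂ, 0 < z.im →
        J₁.diagGreen z k₀ = J₂.diagGreen z k₀ ∧
        J₁.green z k₀ (k₀ + 1) = J₂.green z k₀ (k₀ + 1)) →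
      J₁.op = J₂.op ∧ J₁.A = J₂.A ∧ J₁.B = J₂.B) ∧
    ((∀ z : ℂ, 0 < z.im →
        J₁.diagGreen z k₀ = J₂.diagGreen z k₀ ∧
        J₁.green z k₀ (k₀ + 1) + J₁.green z (k₀ + 1) k₀ =
          J₂.green z k₀ (k₀ + 1) + J₂.green z (k₀ + 1) k₀) →
      J₁.op = J₂.op ∧ J₁.A = J₂.A ∧ J₁.B = J₂.B) ∧
    ((∀ z : ℂ, 0 < z.im →
        J₁.diagGreen z k₀ = J₂.diagGreen z k₀ ∧
        J₁.diagGreen z (k₀ + 1) = J₂.diagGreen z (k₀ + 1)) →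
      J₁.A k₀ = J₂.A k₀ →
      J₁.op = J₂.op ∧ J₁.A = J₂.A ∧ J₁.B = J₂.B) := by
  -- The data along `z = iy`, `y → +∞`, already suffice.
  set l : Filter ℂ := map (fun y : ℝ => (y : ℂ) * Complex.I) atTop
  have hl : l ≤ cobounded ℂ := by
    refine tendsto_norm_atTop_iff_cobounded.mp ?_
    simpa [Function.comp_def] using tendsto_abs_atTop_atTop
  have him : ∀ᶠ z in l, 0 < z.im := by
    refine eventually_map.mpr ?_
    filter_upwards [eventually_gt_atTop 0] with y hy
    simpa using hy
  have concl (h : J₁ = J₂) : J₁.op = J₂.op ∧ J₁.A = J₂.A ∧ J₁.B = J₂.B := by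
    subst h; exact ⟨rfl, rfl, rfl⟩
  refine ⟨fun h => concl ?_, fun h => concl ?_, fun h hA => concl ?_⟩
  · refine JacobiCoeff.eq_of_eventually_block_resolvent_eq hl (k₀ := k₀) ?_ ?_
    · filter_upwards [him] with z hz using JacobiCoeff.green_eq_iff.mp (h z hz).1
    · filter_upwards [him] with z hz using JacobiCoeff.green_eq_iff.mp (h z hz).2
  · refine JacobiCoeff.eq_of_eventually_block_resolvent_add_eq hl (k₀ := k₀) ?_ ?_
    · filter_upwards [him] with z hz using JacobiCoeff.green_eq_iff.mp (h z hz).1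
    · filter_upwards [him] with z hz
      have := congrArg (Matrix.toEuclideanCLM (𝕜 := ℂ)) (h z hz).2
      rw [map_add, map_add] at this
      simp only [JacobiCoeff.toEuclideanCLM_green] at this
      rwa [← neg_add, ← neg_add, neg_inj] at this
  · refine JacobiCoeff.eq_of_eventually_block_resolvent_diag_eq hl (k₀ := k₀) ?_ ?_ ?_
    · filter_upwards [him] with z hz using JacobiCoeff.green_eq_iff.mp (h z hz).1
    · filter_upwards [him] with z hz using JacobiCoeff.green_eq_iff.mp (h z hz).2
    · rw [JacobiCoeff.opA, JacobiCoeff.opA, hA]
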